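/- Let $0<d^-\leqslant d^+$ be real numbers. There exist positive constants $\eta=\eta(d^-,d^+)$ and $C=C(d^-,d^+)$, depending on $d^-$ and $d^+$ only, such that the following holds. Let $(d_j)_{j\geqslant 1}$ be real numbers with $d^-\leqslant d_j\leqslant d^+$ for all $j\geqslant 1$, let $(\hat f(j))_{j\geqslant 1}$ be complex numbers with $|\hat f(j)|\leqslant 1$ for all $j\geqslant 1$, and define $p_n$ and $M_n$ by $$ \sum_{n=0}^\infty p_nz^n=\exp\Bigl\{\sum_{j=1}^\infty \frac{d_j}{j}z^j\Bigr\},\qquad \sum_{n=0}^\infty M_nz^n=\exp\Bigl\{\sum_{j=1}^\infty \frac{d_j\hat f(j)}{j}z^j\Bigr\}. $$ Put, for $n\geqslant 0$ and $u>0$, $$ L_n(z)=\sum_{j=1}^n d_j\frac{\hat f(j)-1}{j}z^j,\qquad E(u)=\exp\Bigl\{2\sum_{\substack{1\leqslant k\leqslant n\\ |\hat f(k)-1|>u}}\frac{|\hat f(k)-1|}{k}\Bigr\}. $$ Then for every $n\geqslant 0$ and every $u$ with $0<u\leqslant\eta$, $$ \bigl|M_n\,p_n^{-1}\bigr|\leqslant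 C\,\bigl|\exp\{L_n(1)\}\bigr|\,\bigl(E(u)\bigr)^{d^+}. $$ -/

import Mathlib

noncomputable section

namespace VoronoiMean

/-- The formal power series `∑_{k ≥ 1} (c k / k) z ^ k`; the value `c 0` is not used. -/
def logSeries {K : Type*} [Field K] (c : ℕ → K) : PowerSeries K :=
  PowerSeries.mk fun k => if k = 0 then 0 else c k / (k : K)

/-- The formal power series `exp (∑_{k ≥ 1} (c k / k) z ^ k)`. The inner series has constant
coefficient `0`, so the substitution into the exponential series is legitimate. -/
def expSeries {K : Type*} [Field K] [Algebra ℚ K] (c : ℕ → K) : PowerSeries K :=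
  (PowerSeries.exp K).subst (logSeries c)

/-- `p_n`, the coefficient of `z ^ n` in `p(z) = exp (∑_{k ≥ 1} (d_k / k) z ^ k)`. -/
def pCoeff (d : ℕ → ℝ) (n : ℕ) : ℝ :=
  PowerSeries.coeff n (expSeries d)

/-- `M_n`, the coefficient of `z ^ n` in `M(z) = exp (∑_{k ≥ 1} (d_k f_k / k) z ^ k)`. -/
def MCoeff (d : ℕ → ℝ) (f : ℕ → ℂ) (n : ℕ) : ℂ :=
  PowerSeries.coeff n (expSeries fun k => (d k : ℂ) * f k)

/-- `L_n(z) = ∑_{j=1}^n d_j (f_j - 1) / j * z ^ j`. -/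
def L (d : ℕ → ℝ) (f : ℕ → ℂ) (n : ℕ) (z : ℂ) : ℂ :=
  ∑ j ∈ Finset.Icc 1 n, (d j : ℂ) * ((f j - 1) / (j : ℂ)) * z ^ j

/-- `E(u) = exp (2 ∑_{1 ≤ k ≤ n, |f_k - 1| > u} |f_k - 1| / k)`. -/
def E (f : ℕ → ℂ) (n : ℕ) (u : ℝ) : ℝ :=
  Real.exp (2 * ∑ k ∈ Finset.Icc 1 n with u < ‖f k - 1‖, ‖f k - 1‖ / (k : ℝ))

end VoronoiMean

end

/-!
Logarithmic differentiation of `exp (∑ (c_j / j) z ^ j)` gives `n a_n = ∑_{i < n} a_i c_{n - i}`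
for its coefficients. Applied to `M_n` and to `p_n`, it reduces the theorem to comparing
`∑_{k ≤ n} |M_k|` with `∑_{k < n} p_k`.

Upper bound: for `n / 2 < k ≤ n` replace `M` by the exponential of its exponent truncated at `n`.
Since `z M' = M · z (log M)'`, Parseval's identity bounds `∑ |k M_k|²` by `O(n)` times the squared
maximum of the truncated `|M|` on the unit circle. Comparing `Re (f_j z ^ j)` with `Re f_j` and
using `∑_{j ≤ n} (|z ^ j - 1| - 2 (1 - Re (z ^ j))) / j ≤ 5`, that maximum is at most a constant
times `exp (∑_{j ≤ n} d_j / j) · |exp (L_n(1))| · E(u) ^ d⁺`. For small `u` this majorant grows by a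
factor bounded away from `1` when `n` doubles, so the dyadic blocks add up geometrically.

Lower bound: if `m` is a small fraction of `n`, then at least half of the coefficient sum
`exp (∑_{j ≤ m} d_j / j)` of `exp (∑_{j ≤ m} (d_j / j) z ^ j)` comes from indices `k < n`, where the
coefficient is at most `p_k`; and the terms `d_j / j` with `m < j ≤ n` add up to `O(1)`.
-/

namespace VoronoiMean

open Filter Finset Topology
open scoped Polynomial
open Polynomial (derivative)
open PowerSeries (coeff trunc)

section Recurrence

variable {K : Type*} [Field K]

lemma hasSubst_logSeries (c : ℕ → K) : PowerSeries.HasSubst (logSeries c) :=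
  .of_constantCoeff_zero' (by simp [logSeries])

lemma coeff_derivative_logSeries [CharZero K] (c : ℕ → K) (k : ℕ) :
    coeff k (PowerSeries.derivative K (logSeries c)) = c (k + 1) := by
  rw [PowerSeries.coeff_derivative, logSeries, PowerSeries.coeff_mk, if_neg k.succ_ne_zero,
    ← Nat.cast_add_one, div_mul_cancel₀ _ (Nat.cast_ne_zero.2 k.succ_ne_zero)]

variable [Algebra ℚ K]

lemma coeff_zero_expSeries (c : ℕ → K) : coeff 0 (expSeries c) = 1 := by
  have h0 : PowerSeries.constantCoeff (logSeries c) = 0 := by simp [logSeries]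
  rw [expSeries, PowerSeries.coeff_subst' (hasSubst_logSeries c), finsum_eq_single _ 0] <;>
    simp +contextual [h0]

lemma derivative_expSeries (c : ℕ → K) :
    PowerSeries.derivative K (expSeries c) =
      expSeries c * PowerSeries.derivative K (logSeries c) := by
  rw [expSeries, PowerSeries.derivative_subst (hasSubst_logSeries c), PowerSeries.derivative_exp]

lemma natCast_mul_coeff_expSeries (c : ℕ → K) (n : ℕ) :
    n * coeff n (expSeries c) = ∑ i ∈ range n, coeff i (expSeries c) * c (n - i) := by
  cases n with
  | zero => simp
  | succ n =>
    have := algebraRat.charZero K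
    have h := congrArg (coeff n) (derivative_expSeries c)
    rw [PowerSeries.coeff_derivative, PowerSeries.coeff_mul,
      Nat.sum_antidiagonal_eq_sum_range_succ_mk] at h
    rw [mul_comm, Nat.cast_add_one, h]
    refine sum_congr rfl fun i hi => ?_
    rw [coeff_derivative_logSeries, Nat.sub_add_comm (mem_range_succ_iff.1 hi)]

lemma coeff_expSeries_eq_of_recurrence {c a : ℕ → K} {n : ℕ} (ha0 : a 0 = 1)
    (ha : ∀ k, 1 ≤ k → k ≤ n → (k : K) * a k = ∑ i ∈ range k, a i * c (k - i)) :
    coeff n (expSeries c) = a n := by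
  have := algebraRat.charZero K
  induction n using Nat.strong_induction_on with
  | _ n ih =>
    rcases n.eq_zero_or_pos with rfl | hn
    · rw [ha0, coeff_zero_expSeries]
    · refine mul_left_cancel₀ (Nat.cast_ne_zero.2 hn.ne') ?_
      rw [natCast_mul_coeff_expSeries, ha n hn le_rfl]
      refine sum_congr rfl fun i hi => ?_
      rw [ih i (mem_range.1 hi) fun k hk hki => ha k hk (hki.trans (mem_range.1 hi).le)]

lemma coeff_expSeries_congr {c c' : ℕ → K} {n : ℕ} (h : ∀ j, 1 ≤ j → j ≤ n → c j = c' j) :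
    coeff n (expSeries c) = coeff n (expSeries c') :=
  coeff_expSeries_eq_of_recurrence (a := fun n => coeff n (expSeries c'))
    (coeff_zero_expSeries c') fun k _ hkn => by
    rw [natCast_mul_coeff_expSeries]
    refine sum_congr rfl fun i hi => ?_
    rw [h (k - i) (Nat.sub_pos_of_lt (mem_range.1 hi)) (by lia)]

lemma coeff_expSeries_map {K' : Type*} [Field K'] [Algebra ℚ K'] (φ : K →+* K') (c : ℕ → K)
    (n : ℕ) : coeff n (expSeries fun k => φ (c k)) = φ (coeff n (expSeries c)) :=
  coeff_expSeries_eq_of_recurrence (a := fun n => φ (coeff n (expSeries c)))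
    (by simp [coeff_zero_expSeries]) fun k _ _ => by
    simp only [← map_natCast φ, ← map_mul, ← map_sum, natCast_mul_coeff_expSeries]

variable [LinearOrder K] [IsStrictOrderedRing K]

lemma coeff_expSeries_nonneg {c : ℕ → K} (hc : ∀ j, 1 ≤ j → 0 ≤ c j) (n : ℕ) :
    0 ≤ coeff n (expSeries c) := by
  induction n using Nat.strong_induction_on with
  | _ n ih =>
    rcases n.eq_zero_or_pos with rfl | hn
    · rw [coeff_zero_expSeries]; exact zero_le_one
    · refine nonneg_of_mul_nonneg_right (a := (n : K)) ?_ (Nat.cast_pos.2 hn)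
      rw [natCast_mul_coeff_expSeries]
      exact sum_nonneg fun i hi =>
        mul_nonneg (ih i (mem_range.1 hi)) (hc _ (Nat.sub_pos_of_lt (mem_range.1 hi)))

lemma coeff_expSeries_le_coeff_expSeries {c c' : ℕ → K} (hc : ∀ j, 1 ≤ j → 0 ≤ c j)
    (hcc' : ∀ j, 1 ≤ j → c j ≤ c' j) (n : ℕ) :
    coeff n (expSeries c) ≤ coeff n (expSeries c') := by
  induction n using Nat.strong_induction_on with
  | _ n ih =>
    rcases n.eq_zero_or_pos with rfl | hn
    · rw [coeff_zero_expSeries, coeff_zero_expSeries]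
    · refine le_of_mul_le_mul_left ?_ (Nat.cast_pos.2 hn : (0 : K) < n)
      rw [natCast_mul_coeff_expSeries, natCast_mul_coeff_expSeries]
      refine sum_le_sum fun i hi => ?_
      have hi' : 1 ≤ n - i := Nat.sub_pos_of_lt (mem_range.1 hi)
      exact mul_le_mul (ih i (mem_range.1 hi)) (hcc' _ hi') (hc _ hi')
        (coeff_expSeries_nonneg (fun j hj => (hc j hj).trans (hcc' j hj)) i)

end Recurrence

section Truncation

variable {K : Type*} [Field K]

/-- The polynomial `∑_{1 ≤ k ≤ m} (c k / k) X ^ k` truncating `logSeries c`. -/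
noncomputable def logPoly (c : ℕ → K) (m : ℕ) : K[X] :=
  trunc (m + 1) (logSeries c)

lemma eval_logPoly (c : ℕ → K) (m : ℕ) (z : K) :
    (logPoly c m).eval z = ∑ j ∈ Ioc 0 m, c j / (j : K) * z ^ j := by
  rw [logPoly, Polynomial.eval, PowerSeries.eval₂_trunc_eq_sum_range,
    Nat.range_succ_eq_Icc_zero, ← add_sum_Ioc_eq_sum_Icc m.zero_le]
  simp only [logSeries, PowerSeries.coeff_mk, RingHom.id_apply, if_true, zero_mul, zero_add]
  refine sum_congr rfl fun j hj => ?_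
  rw [if_neg (mem_Ioc.1 hj).1.ne']

lemma logSeries_indicator_Iic (c : ℕ → K) (m : ℕ) :
    logSeries ((Set.Iic m).indicator c) = (logPoly c m : PowerSeries K) := by
  ext k
  simp only [logPoly, logSeries, Polynomial.coeff_coe, PowerSeries.coeff_trunc,
    PowerSeries.coeff_mk, Set.indicator_apply, Set.mem_Iic, Nat.lt_succ_iff]
  split_ifs <;> simp

lemma coeff_derivative_logPoly [CharZero K] (c : ℕ → K) (m k : ℕ) :
    (derivative (logPoly c m)).coeff k = (Set.Iic m).indicator c (k + 1) := by
  rw [← coeff_derivative_logSeries ((Set.Iic m).indicator c), logSeries_indicator_Iic,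
    PowerSeries.derivative_coe, Polynomial.coeff_coe]

lemma iteratedDeriv_eval_zero {𝕜 : Type*} [NontriviallyNormedField 𝕜] (p : 𝕜[X]) (n : ℕ) :
    iteratedDeriv n (fun z => p.eval z) 0 = n.factorial * p.coeff n := by
  have h : iteratedDeriv n (fun z => p.eval z) = fun z => (derivative^[n] p).eval z := by
    induction n with
    | zero => simp
    | succ n ih => rw [iteratedDeriv_succ, ih, Function.iterate_succ_apply']; ext; simp
  rw [congrFun h, ← Polynomial.coeff_zero_eq_eval_zero,
    Polynomial.coeff_iterate_derivative, zero_add, Nat.descFactorial_self, nsmul_eq_mul]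

lemma hasSum_coeff_expSeries_mul_pow (c : ℕ → ℂ) (m : ℕ) (z : ℂ) :
    HasSum (fun k => coeff k (expSeries ((Set.Iic m).indicator c)) * z ^ k)
      (Complex.exp ((logPoly c m).eval z)) := by
  set F : ℂ → ℂ := fun z => Complex.exp ((logPoly c m).eval z)
  set q : ℂ → ℂ := fun z => (derivative (logPoly c m)).eval z
  have hF : Differentiable ℂ F := by fun_prop
  have hq : Differentiable ℂ q := by fun_prop
  have hF' : deriv F = F * q := by
    ext z
    exact ((logPoly c m).hasDerivAt z).cexp.deriv
  have ha : ∀ n, coeff n (expSeries ((Set.Iic m).indicator c)) =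
      (n.factorial : ℂ)⁻¹ * iteratedDeriv n F 0 := fun n => by
    refine coeff_expSeries_eq_of_recurrence
      (a := fun n => (n.factorial : ℂ)⁻¹ * iteratedDeriv n F 0) ?_ fun k hk _ => ?_
    · simp [F, ← Polynomial.coeff_zero_eq_eval_zero, logPoly, PowerSeries.coeff_trunc, logSeries]
    · obtain ⟨k, rfl⟩ := Nat.exists_eq_add_of_le' hk
      rw [iteratedDeriv_succ', hF', iteratedDeriv_mul hF.contDiff.contDiffAt
        hq.contDiff.contDiffAt, mul_sum, mul_sum]
      refine sum_congr rfl fun i hi => ?_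
      have hik := mem_range_succ_iff.1 hi
      rw [iteratedDeriv_eval_zero, coeff_derivative_logPoly, Nat.cast_choose ℂ hik,
        ← Nat.sub_add_comm hik, Nat.factorial_succ]
      have hk_fact := Nat.cast_ne_zero (R := ℂ).2 k.factorial_ne_zero
      have hki_fact := Nat.cast_ne_zero (R := ℂ).2 (k - i).factorial_ne_zero
      have hk_succ := Nat.cast_ne_zero (R := ℂ).2 k.succ_ne_zero
      push_cast at hk_succ ⊢
      field_simp
  refine (Complex.hasSum_taylorSeries_of_entire hF 0 z).congr_fun fun k => ?_
  rw [ha, sub_zero, smul_eq_mul, smul_eq_mul]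
  ring

end Truncation

section MeanSquare

lemma sum_sq_norm_coeff_le_circleAverage (p : ℂ[X]) (s : Finset ℕ) :
    ∑ k ∈ s, ‖p.coeff k‖ ^ 2 ≤ Real.circleAverage (fun z => ‖p.eval z‖ ^ 2) 0 1 := by
  rw [← p.sum_sq_norm_coeff_eq_circleAverage,
    ← sum_filter_of_ne (p := (· ∈ p.support)) fun k _ hk =>
    Polynomial.mem_support_iff.2 fun h => hk (by simp [h])]
  exact sum_le_sum_of_subset_of_nonneg (fun k hk => (mem_filter.1 hk).2) fun _ _ _ => by positivity

lemma circleIntegrable_sq_norm_eval (p : ℂ[X]) :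
    CircleIntegrable (fun z => ‖p.eval z‖ ^ 2) 0 1 :=
  ContinuousOn.circleIntegrable zero_le_one (by fun_prop)

lemma sum_sq_norm_coeff_mul_le {p : ℂ[X]} {B : ℝ} (hB : ∀ z : ℂ, ‖z‖ = 1 → ‖p.eval z‖ ≤ B)
    (q : ℂ[X]) (s : Finset ℕ) :
    ∑ k ∈ s, ‖(p * q).coeff k‖ ^ 2 ≤ B ^ 2 * ∑ k ∈ q.support, ‖q.coeff k‖ ^ 2 := by
  refine (sum_sq_norm_coeff_le_circleAverage _ s).trans ?_
  rw [q.sum_sq_norm_coeff_eq_circleAverage, ← smul_eq_mul (B ^ 2), ← Real.circleAverage_fun_smul]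
  refine Real.circleAverage_mono (circleIntegrable_sq_norm_eval _)
    (ContinuousOn.circleIntegrable zero_le_one (by fun_prop)) fun z hz => ?_
  have hz : ‖z‖ = 1 := by simpa using hz
  rw [smul_eq_mul, Polynomial.eval_mul, norm_mul, mul_pow]
  gcongr
  exact hB z hz

variable {φ : PowerSeries ℂ} {F : ℂ → ℂ} {M : ℝ}

lemma eventually_norm_eval_trunc_le
    (hφ : ∀ z, ‖z‖ = 1 → HasSum (fun k => coeff k φ * z ^ k) (F z))
    (hF : ∀ z, ‖z‖ = 1 → ‖F z‖ ≤ M) {B : ℝ} (hB : M < B) :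
    ∀ᶠ N in atTop, ∀ z : ℂ, ‖z‖ = 1 → ‖(trunc N φ).eval z‖ ≤ B := by
  have hsum : Summable fun k => ‖coeff k φ‖ := by simpa using (hφ 1 norm_one).summable.norm
  have hunif := tendstoUniformlyOn_tsum_nat hsum (s := {z : ℂ | ‖z‖ = 1})
    (f := fun k z => coeff k φ * z ^ k) fun k z hz => by simp [hz.out]
  filter_upwards [Metric.tendstoUniformlyOn_iff.1 hunif _ (sub_pos.2 hB)] with N hN z hz
  have h := hN z hz
  rw [(hφ z hz).tsum_eq, dist_eq_norm'] at h
  rw [Polynomial.eval, PowerSeries.eval₂_trunc_eq_sum_range]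
  calc _ ≤ ‖F z‖ + ‖∑ k ∈ range N, coeff k φ * z ^ k - F z‖ := norm_le_norm_add_norm_sub' _ _
    _ ≤ B := by linarith [hF z hz]

lemma sum_sq_norm_coeff_mul_coe_le
    (hφ : ∀ z, ‖z‖ = 1 → HasSum (fun k => coeff k φ * z ^ k) (F z))
    (hF : ∀ z, ‖z‖ = 1 → ‖F z‖ ≤ M) (q : ℂ[X]) (n : ℕ) :
    ∑ k ∈ range n, ‖coeff k (φ * (q : PowerSeries ℂ))‖ ^ 2 ≤
      M ^ 2 * ∑ k ∈ q.support, ‖q.coeff k‖ ^ 2 := by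
  have hlim : Tendsto (fun B : ℝ => B ^ 2 * ∑ k ∈ q.support, ‖q.coeff k‖ ^ 2) (𝓝[>] M)
      (𝓝 (M ^ 2 * ∑ k ∈ q.support, ‖q.coeff k‖ ^ 2)) :=
    tendsto_nhdsWithin_of_tendsto_nhds (Continuous.tendsto (by fun_prop) M)
  refine ge_of_tendsto hlim ?_
  filter_upwards [self_mem_nhdsWithin] with B hB
  obtain ⟨N, hN, hnN⟩ :=
    ((eventually_norm_eval_trunc_le hφ hF hB).and (eventually_ge_atTop n)).exists
  refine (sum_congr rfl fun k hk => ?_).trans_le (sum_sq_norm_coeff_mul_le hN q (range n))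
  congr 2
  rw [PowerSeries.coeff_mul, Polynomial.coeff_mul]
  refine sum_congr rfl fun ij hij => ?_
  rw [PowerSeries.coeff_trunc, if_pos, Polynomial.coeff_coe]
  have := HasAntidiagonal.mem_antidiagonal.1 hij
  have := mem_range.1 hk
  lia

lemma sum_sq_natCast_mul_norm_coeff_expSeries_le {c : ℕ → ℂ} {n : ℕ} {W : ℝ}
    (hW : ∀ z : ℂ, ‖z‖ = 1 → ((logPoly c n).eval z).re ≤ W) :
    ∑ k ∈ range (n + 1), (k * ‖coeff k (expSeries c)‖) ^ 2 ≤
      Real.exp W ^ 2 * ∑ j ∈ Ioc 0 n, ‖c j‖ ^ 2 := by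
  set φ := expSeries ((Set.Iic n).indicator c)
  set q := Polynomial.X * derivative (logPoly c n)
  have hq (k : ℕ) : q.coeff k = if k ∈ Ioc 0 n then c k else 0 := by
    cases k <;> simp [q, coeff_derivative_logPoly, Set.indicator_apply]
  have hexp : ∀ z : ℂ, ‖z‖ = 1 → ‖Complex.exp ((logPoly c n).eval z)‖ ≤ Real.exp W :=
    fun z hz => by rw [Complex.norm_exp]; exact Real.exp_le_exp.2 (hW z hz)
  have hφq : φ * (q : PowerSeries ℂ) = PowerSeries.X * PowerSeries.derivative ℂ φ := by
    rw [derivative_expSeries, logSeries_indicator_Iic, PowerSeries.derivative_coe,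
      Polynomial.coe_mul, Polynomial.coe_X]
    ring
  have hcoeff (k : ℕ) : coeff k (φ * (q : PowerSeries ℂ)) = k * coeff k φ := by
    cases k with
    | zero => simp [hφq]
    | succ k =>
      rw [hφq, PowerSeries.coeff_succ_X_mul, PowerSeries.coeff_derivative, mul_comm,
        Nat.cast_add_one]
  have hsupp : q.support ⊆ Ioc 0 n := fun k hk => by
    by_contra h
    exact Polynomial.mem_support_iff.1 hk (by rw [hq, if_neg h])
  calc _ = ∑ k ∈ range (n + 1), ‖coeff k (φ * (q : PowerSeries ℂ))‖ ^ 2 := by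
        refine sum_congr rfl fun k hk => ?_
        rw [hcoeff, norm_mul, Complex.norm_natCast, coeff_expSeries_congr fun j _ hjk => ?_]
        exact (Set.indicator_of_mem (Set.mem_Iic.2 (hjk.trans (mem_range_succ_iff.1 hk))) c).symm
    _ ≤ _ := sum_sq_norm_coeff_mul_coe_le
        (fun z _ => hasSum_coeff_expSeries_mul_pow c n z) hexp q _
    _ ≤ Real.exp W ^ 2 * ∑ j ∈ Ioc 0 n, ‖q.coeff j‖ ^ 2 := by gcongr
    _ = _ := by rw [sum_congr rfl fun j hj => by rw [hq, if_pos hj]]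

lemma sum_Ico_norm_coeff_expSeries_le {c : ℕ → ℂ} {B W : ℝ} (hc : ∀ j, 1 ≤ j → ‖c j‖ ≤ B) {n : ℕ}
    (hW : ∀ z : ℂ, ‖z‖ = 1 → ((logPoly c n).eval z).re ≤ W) :
    ∑ k ∈ Ico (n / 2 + 1) (n + 1), ‖coeff k (expSeries c)‖ ≤ 2 * B * Real.exp W := by
  set s := Ico (n / 2 + 1) (n + 1)
  set a : ℕ → ℝ := fun k => ‖coeff k (expSeries c)‖
  have hB : 0 ≤ B := (norm_nonneg _).trans (hc 1 le_rfl)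
  rcases n.eq_zero_or_pos with rfl | hn
  · simpa [s] using mul_nonneg (mul_nonneg zero_le_two hB) (Real.exp_nonneg W)
  have hhalf : n / 2 * ∑ k ∈ s, a k ≤ ∑ k ∈ s, k * a k := by
    rw [mul_sum]
    refine sum_le_sum fun k hk => mul_le_mul_of_nonneg_right ?_ (norm_nonneg _)
    rw [div_le_iff₀ two_pos]
    exact_mod_cast (by grind : n ≤ k * 2)
  have hcard : (#s : ℝ) ≤ n := by
    rw [Nat.card_Ico]
    exact_mod_cast (by lia : n + 1 - (n / 2 + 1) ≤ n)
  have hsq : (∑ k ∈ s, k * a k) ^ 2 ≤ (n * (B * Real.exp W)) ^ 2 := by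
    calc _ ≤ #s * ∑ k ∈ s, (k * a k) ^ 2 := sq_sum_le_card_mul_sum_sq
      _ ≤ n * ∑ k ∈ range (n + 1), (k * a k) ^ 2 := by
        gcongr
        exact fun k hk => mem_range.2 (mem_Ico.1 hk).2
      _ ≤ n * (Real.exp W ^ 2 * ∑ j ∈ Ioc 0 n, ‖c j‖ ^ 2) := by
        gcongr
        exact sum_sq_natCast_mul_norm_coeff_expSeries_le hW
      _ ≤ n * (Real.exp W ^ 2 * ∑ j ∈ Ioc 0 n, B ^ 2) := by
        gcongr with j hj
        exact hc j (mem_Ioc.1 hj).1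
      _ = _ := by simp; ring
  have := hhalf.trans (le_of_sq_le_sq hsq (by positivity))
  have hn' : (0 : ℝ) < n := by exact_mod_cast hn
  refine le_of_mul_le_mul_left ?_ (half_pos hn')
  linarith

lemma sum_norm_coeff_expSeries_le {c : ℕ → ℂ} {V : ℕ → ℝ} {B β κ : ℝ} (hκ : 0 < κ)
    (hc : ∀ j, 1 ≤ j → ‖c j‖ ≤ B) (hV₀ : 0 ≤ V 0) (hV : ∀ n, 0 < n → V (n / 2) + κ ≤ V n)
    (hcV : ∀ n, ∀ z : ℂ, ‖z‖ = 1 → ((logPoly c n).eval z).re ≤ V n + β) (n : ℕ) :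
    ∑ k ∈ range (n + 1), ‖coeff k (expSeries c)‖ ≤
      (1 + 2 * B * Real.exp β / (1 - Real.exp (-κ))) * Real.exp (V n) := by
  set θ := Real.exp (-κ)
  have hθ : 0 < 1 - θ := sub_pos.2 (Real.exp_lt_one_iff.2 (neg_lt_zero.2 hκ))
  have hB : 0 ≤ B := (norm_nonneg _).trans (hc 1 le_rfl)
  set A := 1 + 2 * B * Real.exp β / (1 - θ)
  have hA : 1 ≤ A := le_add_of_nonneg_right (by positivity)
  have hstep : A * θ + 2 * B * Real.exp β ≤ A := by
    have : (A - 1) * (1 - θ) = 2 * B * Real.exp β := by simp [A, hθ.ne']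
    linarith
  induction n using Nat.strong_induction_on with
  | _ n ih =>
    rcases n.eq_zero_or_pos with rfl | hn
    · simpa [coeff_zero_expSeries] using one_le_mul_of_one_le_of_one_le hA (Real.one_le_exp hV₀)
    have hhalf : Real.exp (V (n / 2)) ≤ θ * Real.exp (V n) := by
      rw [← Real.exp_add]
      exact Real.exp_le_exp.2 (by linarith [hV n hn])
    have hblock := sum_Ico_norm_coeff_expSeries_le hc (hcV n)
    rw [Real.exp_add] at hblock
    calc _ = ∑ k ∈ range (n / 2 + 1), ‖coeff k (expSeries c)‖ +
          ∑ k ∈ Ico (n / 2 + 1) (n + 1), ‖coeff k (expSeries c)‖ :=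
          (sum_range_add_sum_Ico _ (by lia)).symm
      _ ≤ A * (θ * Real.exp (V n)) + 2 * B * (Real.exp (V n) * Real.exp β) := by
        refine add_le_add ((ih _ (Nat.div_lt_self hn one_lt_two)).trans ?_) hblock
        gcongr
      _ = (A * θ + 2 * B * Real.exp β) * Real.exp (V n) := by ring
      _ ≤ A * Real.exp (V n) := by gcongr

end MeanSquare

section LowerBound

lemma sum_natCast_mul_coeff_expSeries_le {c : ℕ → ℝ} {B : ℝ} (hc : ∀ j, 1 ≤ j → 0 ≤ c j)
    (hB : ∀ N, ∑ j ∈ range N, c (j + 1) ≤ B) (N : ℕ) :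
    ∑ k ∈ range N, k * coeff k (expSeries c) ≤ B * ∑ k ∈ range N, coeff k (expSeries c) := by
  calc ∑ k ∈ range N, k * coeff k (expSeries c)
      = ∑ i ∈ range N, ∑ k ∈ Ico (i + 1) N, coeff i (expSeries c) * c (k - i) := by
        simp_rw [natCast_mul_coeff_expSeries]
        exact sum_comm' fun _ _ => by grind
    _ = ∑ i ∈ range N, coeff i (expSeries c) * ∑ j ∈ range (N - (i + 1)), c (j + 1) := by
        refine sum_congr rfl fun i _ => ?_
        rw [sum_Ico_eq_sum_range, mul_sum]
        exact sum_congr rfl fun j _ => by congr 2; lia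
    _ ≤ ∑ i ∈ range N, coeff i (expSeries c) * B := by
        gcongr with i
        exacts [coeff_expSeries_nonneg hc i, hB _]
    _ = B * ∑ k ∈ range N, coeff k (expSeries c) := by rw [← sum_mul, mul_comm]

lemma sum_range_le_two_mul_sum_range {q : ℕ → ℝ} (hq : ∀ k, 0 ≤ q k) {n : ℕ} (hn : 0 < n) {N : ℕ}
    (hmean : 2 * ∑ k ∈ range N, k * q k ≤ n * ∑ k ∈ range N, q k) :
    ∑ k ∈ range N, q k ≤ 2 * ∑ k ∈ range n, q k := by
  have htail : n * ∑ k ∈ range N \ range n, q k ≤ ∑ k ∈ range N, k * q k := by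
    rw [mul_sum]
    refine (sum_le_sum fun k hk => mul_le_mul_of_nonneg_right ?_ (hq k)).trans
      (sum_le_sum_of_subset_of_nonneg sdiff_subset fun k _ _ => mul_nonneg k.cast_nonneg (hq k))
    exact_mod_cast not_lt.1 fun h => (mem_sdiff.1 hk).2 (mem_range.2 h)
  have hsplit : ∑ k ∈ range N, q k ≤ ∑ k ∈ range n, q k + ∑ k ∈ range N \ range n, q k := by
    rw [← sum_union disjoint_sdiff]
    exact sum_le_sum_of_subset_of_nonneg (by grind) fun k _ _ => hq k
  refine le_of_mul_le_mul_left ?_ (Nat.cast_pos.2 hn : (0 : ℝ) < n)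
  have := mul_le_mul_of_nonneg_left hsplit n.cast_nonneg
  linarith

lemma hasSum_coeff_expSeries_indicator (c : ℕ → ℝ) (m : ℕ) :
    HasSum (fun k => coeff k (expSeries ((Set.Iic m).indicator c)))
      (Real.exp (∑ j ∈ Ioc 0 m, c j / (j : ℝ))) := by
  have hc : (Set.Iic m).indicator (fun k => (c k : ℂ)) =
      fun k => Complex.ofRealHom ((Set.Iic m).indicator c k) := by
    ext k
    simp only [Set.indicator_apply]
    split_ifs <;> simp
  have h := hasSum_coeff_expSeries_mul_pow (fun k => (c k : ℂ)) m 1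
  simp only [hc, coeff_expSeries_map] at h
  simp only [Complex.ofRealHom_eq_coe, eval_logPoly, one_pow, mul_one] at h
  exact_mod_cast h

variable {d : ℕ → ℝ} {D : ℝ}

/- Markov's inequality: the coefficients of `exp (∑_{j ≤ m} (d_j / j) z ^ j)` form, after
normalization, a distribution of mean `∑_{j ≤ m} d_j ≤ n / 2`. -/
lemma exp_sum_div_le_two_mul_sum_pCoeff (hd : ∀ j, 1 ≤ j → 0 ≤ d j) (hdD : ∀ j, 1 ≤ j → d j ≤ D)
    {m n : ℕ} (hn : 0 < n) (hmn : 2 * (D * m) ≤ n) :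
    Real.exp (∑ j ∈ Ioc 0 m, d j / (j : ℝ)) ≤ 2 * ∑ k ∈ range n, pCoeff d k := by
  set q : ℕ → ℝ := fun k => coeff k (expSeries ((Set.Iic m).indicator d))
  have hD : 0 ≤ D := (hd 1 le_rfl).trans (hdD 1 le_rfl)
  have hind (j : ℕ) (hj : 1 ≤ j) : 0 ≤ (Set.Iic m).indicator d j :=
    Set.indicator_apply_nonneg fun _ => hd j hj
  have hq (k : ℕ) : 0 ≤ q k := coeff_expSeries_nonneg hind k
  have hmass (N : ℕ) : ∑ j ∈ range N, (Set.Iic m).indicator d (j + 1) ≤ D * m := by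
    calc _ = ∑ j ∈ range N with j < m, d (j + 1) := by
          simp [sum_filter, Set.indicator_apply]
      _ ≤ ∑ j ∈ range N with j < m, D := sum_le_sum fun _ _ => hdD _ (Nat.succ_pos _)
      _ ≤ ∑ _ ∈ range m, D := sum_le_sum_of_subset_of_nonneg (by grind) fun _ _ _ => hD
      _ = D * m := by simp [mul_comm]
  have hpartial (N : ℕ) : ∑ k ∈ range N, q k ≤ 2 * ∑ k ∈ range n, q k := by
    refine sum_range_le_two_mul_sum_range hq hn ?_
    have := sum_natCast_mul_coeff_expSeries_le hind hmass N
    have := mul_le_mul_of_nonneg_right hmn (sum_nonneg fun k (_ : k ∈ range N) => hq k)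
    linarith
  refine (le_of_tendsto' (hasSum_coeff_expSeries_indicator d m).tendsto_sum_nat hpartial).trans ?_
  gcongr with k
  exact coeff_expSeries_le_coeff_expSeries hind
    (fun j hj => Set.indicator_apply_le' (fun _ => le_rfl) fun _ => hd j hj) k

lemma sum_Ioc_div_le (hD : 0 ≤ D) (hdD : ∀ j, 1 ≤ j → d j ≤ D) {A m n : ℕ}
    (hn : n ≤ A * (m + 1)) : ∑ j ∈ Ioc m n, d j / (j : ℝ) ≤ D * A := by
  have hcard : (#(Ioc m n) : ℝ) ≤ A * (m + 1) := by
    rw [Nat.card_Ioc]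
    exact_mod_cast (n.sub_le m).trans hn
  calc ∑ j ∈ Ioc m n, d j / (j : ℝ) ≤ ∑ j ∈ Ioc m n, D / (m + 1) := by
        gcongr with j hj
        · exact hdD j (m.zero_le.trans_lt (mem_Ioc.1 hj).1)
        · exact_mod_cast (mem_Ioc.1 hj).1
    _ = #(Ioc m n) * (D / (m + 1)) := by rw [sum_const, nsmul_eq_mul]
    _ ≤ A * (m + 1) * (D / (m + 1)) := by gcongr
    _ = D * A := by field_simp

lemma exp_sum_div_le_sum_pCoeff (hd : ∀ j, 1 ≤ j → 0 ≤ d j) (hdD : ∀ j, 1 ≤ j → d j ≤ D)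
    {n : ℕ} (hn : 0 < n) :
    Real.exp (∑ j ∈ Ioc 0 n, d j / (j : ℝ)) ≤
      2 * Real.exp (D * (⌈2 * D⌉₊ + 1)) * ∑ k ∈ range n, pCoeff d k := by
  set A := ⌈2 * D⌉₊ + 1 with hA
  have hD : 0 ≤ D := (hd 1 le_rfl).trans (hdD 1 le_rfl)
  have hmn : 2 * (D * (n / A : ℕ)) ≤ n := by
    have hDA : 2 * D ≤ A := (Nat.le_ceil _).trans (by exact_mod_cast Nat.le_succ _)
    calc 2 * (D * (n / A : ℕ)) = 2 * D * (n / A : ℕ) := by ring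
      _ ≤ A * (n / A : ℕ) := by gcongr
      _ ≤ n := by exact_mod_cast Nat.mul_div_le n A
  have htail : ∑ j ∈ Ioc (n / A) n, d j / (j : ℝ) ≤ D * A :=
    sum_Ioc_div_le hD hdD (Nat.lt_mul_div_succ n (Nat.succ_pos _)).le
  calc Real.exp (∑ j ∈ Ioc 0 n, d j / (j : ℝ))
      ≤ Real.exp (D * A + ∑ j ∈ Ioc 0 (n / A), d j / (j : ℝ)) := by
        rw [← sum_Ioc_consecutive _ (n / A).zero_le (n.div_le_self A), add_comm]
        gcongr
    _ ≤ Real.exp (D * A) * (2 * ∑ k ∈ range n, pCoeff d k) := by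
        rw [Real.exp_add]
        gcongr
        exact exp_sum_div_le_two_mul_sum_pCoeff hd hdD hn hmn
    _ = _ := by
        rw [hA, Nat.cast_add_one]
        ring

end LowerBound

section TrigonometricSum

/- Dirichlet's test by summation by parts: keeping the boundary term `a (K + 1) z ^ (K + 1)`
inside the norm lets the differences of `a` telescope. -/
lemma norm_one_sub_mul_sum_mul_pow_le {a : ℕ → ℝ} {J K : ℕ} (ha : AntitoneOn a (Set.Ioi J))
    (ha₀ : ∀ j, J < j → 0 ≤ a j) (hJK : J ≤ K) {z : ℂ} (hz : ‖z‖ ≤ 1) :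
    ‖(1 - z) * ∑ j ∈ Ioc J K, a j * z ^ j‖ ≤ 2 * a (J + 1) := by
  have hpow (r : ℝ) (hr : 0 ≤ r) (k : ℕ) : ‖(r : ℂ) * z ^ k‖ ≤ r := by
    rw [norm_mul, norm_pow, Complex.norm_of_nonneg hr]
    exact mul_le_of_le_one_right hr (pow_le_one₀ (norm_nonneg z) hz)
  have hboundary : ‖(1 - z) * ∑ j ∈ Ioc J K, a j * z ^ j + a (K + 1) * z ^ (K + 1)‖ ≤
      2 * a (J + 1) - a (K + 1) := by
    induction K, hJK using Nat.le_induction with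
    | base => simpa [two_mul] using hpow _ (ha₀ _ J.lt_succ_self) (J + 1)
    | succ K hK ih =>
      have hdiff : 0 ≤ a (K + 1) - a (K + 2) :=
        sub_nonneg.2 (ha (Nat.lt_succ_of_le hK) (by grind) (K + 1).le_succ)
      calc _ = ‖(1 - z) * ∑ j ∈ Ioc J K, a j * z ^ j + a (K + 1) * z ^ (K + 1) -
            (a (K + 1) - a (K + 2) : ℝ) * z ^ (K + 2)‖ := by
            rw [sum_Ioc_succ_top (by lia)]
            congr 1
            push_cast
            ring
        _ ≤ 2 * a (J + 1) - a (K + 1) + (a (K + 1) - a (K + 2)) :=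
            (norm_sub_le _ _).trans (add_le_add ih (hpow _ hdiff _))
        _ = _ := by ring
  calc _ ≤ ‖(1 - z) * ∑ j ∈ Ioc J K, a j * z ^ j + a (K + 1) * z ^ (K + 1)‖ +
        ‖(a (K + 1) : ℂ) * z ^ (K + 1)‖ := norm_le_add_norm_add _ _
    _ ≤ 2 * a (J + 1) - a (K + 1) + a (K + 1) := by
        gcongr
        exact hpow _ (ha₀ _ (Nat.lt_succ_of_le hJK)) _
    _ = _ := by ring

lemma norm_pow_sub_one_le {R : Type*} [SeminormedRing R] [NormOneClass R] {z : R} (hz : ‖z‖ ≤ 1)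
    (j : ℕ) : ‖z ^ j - 1‖ ≤ j * ‖z - 1‖ := by
  rw [← geom_sum_mul]
  refine (norm_mul_le _ _).trans (mul_le_mul_of_nonneg_right ?_ (norm_nonneg _))
  simpa using norm_sum_le_of_le (range j) (f := (z ^ ·)) fun i _ =>
    (norm_pow_le z i).trans (pow_le_one₀ (norm_nonneg z) hz)

variable {z : ℂ}

lemma norm_sub_one_le_two (hz : ‖z‖ = 1) : ‖z - 1‖ ≤ 2 :=
  (norm_sub_le z 1).trans (by rw [hz, norm_one, one_add_one_eq_two])

lemma sum_Ioc_norm_pow_sub_one_div_le_one (hz : ‖z‖ = 1) {K : ℕ} (hK : K * ‖z - 1‖ ≤ 1) :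
    ∑ j ∈ Ioc 0 K, (‖z ^ j - 1‖ - 2 * (1 - (z ^ j).re)) / (j : ℝ) ≤ 1 := by
  calc _ ≤ ∑ j ∈ Ioc 0 K, ‖z - 1‖ := by
        refine sum_le_sum fun j hj => ?_
        rw [div_le_iff₀ (Nat.cast_pos.2 (mem_Ioc.1 hj).1)]
        have hre : (z ^ j).re ≤ 1 := (Complex.re_le_norm _).trans (by simp [hz])
        linarith [norm_pow_sub_one_le hz.le j]
    _ = K * ‖z - 1‖ := by simp
    _ ≤ 1 := hK

lemma sum_Ioc_norm_pow_sub_one_div_le_four (hz : ‖z‖ = 1) {J K : ℕ} (hJK : J ≤ K)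
    (hJ : 1 ≤ (J + 1) * ‖z - 1‖) :
    ∑ j ∈ Ioc J K, (‖z ^ j - 1‖ - 2 * (1 - (z ^ j).re)) / (j : ℝ) ≤ 4 := by
  set S := ∑ j ∈ Ioc J K, (((j : ℝ)⁻¹ : ℝ) : ℂ) * z ^ j
  have hS : ‖z - 1‖ * ‖S‖ ≤ 2 * ((J : ℝ) + 1)⁻¹ := by
    have := norm_one_sub_mul_sum_mul_pow_le (a := fun j : ℕ => (j : ℝ)⁻¹) (J := J)
      (fun i hi j _ hij => inv_anti₀ (Nat.cast_pos.2 hi.out.pos) (Nat.cast_le.2 hij))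
      (fun j _ => by positivity) hJK hz.le
    rwa [norm_mul, norm_sub_rev, Nat.cast_add_one] at this
  have hS2 : ‖S‖ ≤ 2 := by
    rw [← div_eq_mul_inv, le_div_iff₀ (by positivity)] at hS
    linarith [mul_le_mul_of_nonneg_right hJ (norm_nonneg S)]
  calc _ ≤ ∑ j ∈ Ioc J K, 2 * ((((j : ℝ)⁻¹ : ℝ) : ℂ) * z ^ j).re := by
        refine sum_le_sum fun j _ => ?_
        rw [Complex.re_ofReal_mul, div_eq_mul_inv, mul_comm, mul_left_comm]
        gcongr
        linarith [norm_sub_one_le_two (z := z ^ j) (by simp [hz])]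
    _ = 2 * S.re := by rw [← mul_sum, Complex.re_sum]
    _ ≤ 4 := by linarith [Complex.re_le_norm S]

lemma sum_Ioc_norm_pow_sub_one_div_le_five (hz : ‖z‖ = 1) (K : ℕ) :
    ∑ j ∈ Ioc 0 K, (‖z ^ j - 1‖ - 2 * (1 - (z ^ j).re)) / (j : ℝ) ≤ 5 := by
  rcases eq_or_ne z 1 with rfl | hz1
  · simp
  have hr : 0 < ‖z - 1‖ := norm_pos_iff.2 (sub_ne_zero.2 hz1)
  set J := ⌊1 / ‖z - 1‖⌋₊
  have hJ : J * ‖z - 1‖ ≤ 1 := (le_div_iff₀ hr).1 (Nat.floor_le (by positivity))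
  rcases le_total K J with hKJ | hJK
  · have hK : K * ‖z - 1‖ ≤ 1 := hJ.trans' (by gcongr)
    linarith [sum_Ioc_norm_pow_sub_one_div_le_one hz hK]
  · have hJ' : 1 ≤ (J + 1) * ‖z - 1‖ := (div_le_iff₀ hr).1 (Nat.lt_floor_add_one _).le
    rw [← sum_Ioc_consecutive _ J.zero_le hJK]
    linarith [sum_Ioc_norm_pow_sub_one_div_le_one hz hJ,
      sum_Ioc_norm_pow_sub_one_div_le_four hz hJK hJ']

end TrigonometricSum

section Majorant

/-- The weights whose logarithmic sum is the exponent `logMajorant` of the upper bound: the terms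
with `‖f j - 1‖ > u`, which `E f n u` controls, receive the extra `2 * D * ‖f j - 1‖`. -/
noncomputable def weight (D : ℝ) (d : ℕ → ℝ) (f : ℕ → ℂ) (u : ℝ) (j : ℕ) : ℝ :=
  d j * (f j).re + if u < ‖f j - 1‖ then 2 * D * ‖f j - 1‖ else 0

/-- The logarithm of `exp (∑_{j ≤ n} d_j / j) * |exp (L_n(1))| * E(u) ^ D`, which majorizes the
real part of `∑_{j ≤ n} (d_j f_j / j) z ^ j` on the unit circle up to an additive constant. -/
noncomputable def logMajorant (D : ℝ) (d : ℕ → ℝ) (f : ℕ → ℂ) (u : ℝ) (n : ℕ) : ℝ :=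
  ∑ j ∈ Ioc 0 n, weight D d f u j / (j : ℝ)

variable {δ D u : ℝ} {d : ℕ → ℝ} {f : ℕ → ℂ}

lemma half_le_weight (hδ : 0 ≤ δ) (hu : 2 * D * u ≤ δ) {j : ℕ} (hd : δ ≤ d j) (hdD : d j ≤ D) :
    δ / 2 ≤ weight D d f u j := by
  have hre : d j * (1 - ‖f j - 1‖) ≤ d j * (f j).re := by
    have h := Complex.abs_re_le_norm (f j - 1)
    rw [Complex.sub_re, Complex.one_re] at h
    exact mul_le_mul_of_nonneg_left (by linarith [neg_abs_le ((f j).re - 1)]) (hδ.trans hd)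
  have hDf : d j * ‖f j - 1‖ ≤ D * ‖f j - 1‖ := by gcongr
  rw [weight]
  split_ifs with h
  · have : 0 ≤ D * ‖f j - 1‖ := mul_nonneg (by linarith) (norm_nonneg _)
    linarith
  · have : D * ‖f j - 1‖ ≤ D * u := mul_le_mul_of_nonneg_left (not_lt.1 h) (by linarith)
    linarith

lemma mul_norm_mul_norm_sub_one_le (hδ : 0 ≤ δ) (hD : 0 ≤ D) (hu : 2 * D * u ≤ δ) (w : ℂ) {z : ℂ}
    (hz : ‖z‖ = 1) :
    D * (‖w‖ * ‖z - 1‖) ≤ (if u < ‖w‖ then 2 * D * ‖w‖ else 0) + δ / 2 * ‖z - 1‖ := by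
  have hDw : 0 ≤ D * ‖w‖ := mul_nonneg hD (norm_nonneg w)
  split_ifs with h
  · have hδz : 0 ≤ δ / 2 * ‖z - 1‖ := by positivity
    linarith [mul_le_mul_of_nonneg_left (norm_sub_one_le_two hz) hDw]
  · have hDδ : D * ‖w‖ ≤ δ / 2 := by linarith [mul_le_mul_of_nonneg_left (not_lt.1 h) hD]
    linarith [mul_le_mul_of_nonneg_right hDδ (norm_nonneg (z - 1))]

lemma mul_re_mul_le_weight (hδ : 0 ≤ δ) (hu : 2 * D * u ≤ δ) {j : ℕ} (hd : δ ≤ d j)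
    (hdD : d j ≤ D) {z : ℂ} (hz : ‖z‖ = 1) :
    d j * (f j * z).re ≤ weight D d f u j + δ / 2 * (‖z - 1‖ - 2 * (1 - z.re)) := by
  have hsplit : (f j * z).re = (f j).re - (1 - z.re) + ((f j - 1) * (z - 1)).re := by
    simp
    ring
  have hcross : d j * ((f j - 1) * (z - 1)).re ≤ D * (‖f j - 1‖ * ‖z - 1‖) := by
    rw [← norm_mul]
    exact (mul_le_mul_of_nonneg_left (Complex.re_le_norm _) (hδ.trans hd)).trans
      (mul_le_mul_of_nonneg_right hdD (norm_nonneg _))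
  have hre : δ * (1 - z.re) ≤ d j * (1 - z.re) :=
    mul_le_mul_of_nonneg_right hd (sub_nonneg.2 (hz ▸ Complex.re_le_norm z))
  have := mul_norm_mul_norm_sub_one_le hδ ((hδ.trans hd).trans hdD) hu (f j - 1) hz
  rw [weight, hsplit]
  linarith

lemma re_eval_logPoly_le (hδ : 0 ≤ δ) (hu : 2 * D * u ≤ δ) (hd : ∀ j, 1 ≤ j → δ ≤ d j ∧ d j ≤ D)
    (n : ℕ) {z : ℂ} (hz : ‖z‖ = 1) :
    ((logPoly (fun k => (d k : ℂ) * f k) n).eval z).re ≤ logMajorant D d f u n + 5 / 2 * δ := by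
  calc _ = ∑ j ∈ Ioc 0 n, d j * (f j * z ^ j).re / (j : ℝ) := by
        rw [eval_logPoly, Complex.re_sum]
        refine sum_congr rfl fun j _ => ?_
        rw [div_mul_eq_mul_div, mul_assoc, Complex.div_natCast_re, Complex.re_ofReal_mul]
    _ ≤ ∑ j ∈ Ioc 0 n, (weight D d f u j + δ / 2 * (‖z ^ j - 1‖ - 2 * (1 - (z ^ j).re))) / j := by
        gcongr with j hj
        obtain ⟨hδd, hdD⟩ := hd j (mem_Ioc.1 hj).1
        exact mul_re_mul_le_weight hδ hu hδd hdD (by simp [hz])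
    _ = logMajorant D d f u n +
          δ / 2 * ∑ j ∈ Ioc 0 n, (‖z ^ j - 1‖ - 2 * (1 - (z ^ j).re)) / (j : ℝ) := by
        simp only [logMajorant, mul_sum, ← sum_add_distrib, add_div, mul_div_assoc]
    _ ≤ logMajorant D d f u n + δ / 2 * 5 := by
        gcongr
        exact sum_Ioc_norm_pow_sub_one_div_le_five hz n
    _ = _ := by ring

lemma logMajorant_half_add_le (hδ : 0 ≤ δ) (hu : 2 * D * u ≤ δ)
    (hd : ∀ j, 1 ≤ j → δ ≤ d j ∧ d j ≤ D) {n : ℕ} (hn : 0 < n) :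
    logMajorant D d f u (n / 2) + δ / 4 ≤ logMajorant D d f u n := by
  have hcard : (n : ℝ) / 2 ≤ #(Ioc (n / 2) n) := by
    rw [Nat.card_Ioc, div_le_iff₀ two_pos]
    exact_mod_cast (by lia : n ≤ (n - n / 2) * 2)
  rw [logMajorant, logMajorant, ← sum_Ioc_consecutive _ (n / 2).zero_le (n.div_le_self 2)]
  gcongr
  calc δ / 4 = n / 2 * (δ / 2 / n) := by
        field_simp
        norm_num
    _ ≤ #(Ioc (n / 2) n) * (δ / 2 / n) := by gcongr
    _ = ∑ j ∈ Ioc (n / 2) n, δ / 2 / n := by rw [sum_const, nsmul_eq_mul]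
    _ ≤ ∑ j ∈ Ioc (n / 2) n, weight D d f u j / (j : ℝ) := by
        refine sum_le_sum fun j hj => ?_
        obtain ⟨hj, hjn⟩ := mem_Ioc.1 hj
        have hj₀ : 0 < j := hj.pos
        obtain ⟨hδd, hdD⟩ := hd j hj₀
        have hw := half_le_weight (f := f) hδ hu hδd hdD
        gcongr
        exact (div_nonneg hδ zero_le_two).trans hw

lemma exp_logMajorant (D : ℝ) (d : ℕ → ℝ) (f : ℕ → ℂ) (u : ℝ) (n : ℕ) :
    Real.exp (logMajorant D d f u n) =
      Real.exp (∑ j ∈ Ioc 0 n, d j / (j : ℝ)) * (‖Complex.exp (L d f n 1)‖ * E f n u ^ D) := by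
  rw [Complex.norm_exp, E, ← Real.exp_mul, ← Real.exp_add, ← Real.exp_add, L, Complex.re_sum,
    mul_sum, sum_filter, sum_mul, logMajorant, ← Icc_add_one_left_eq_Ioc, zero_add,
    ← sum_add_distrib, ← sum_add_distrib]
  refine congrArg Real.exp (sum_congr rfl fun j _ => ?_)
  rw [one_pow, mul_one, Complex.re_ofReal_mul, Complex.div_natCast_re, weight, Complex.sub_re,
    Complex.one_re]
  split_ifs <;> ring

end Majorant

section Comparison

lemma natCast_mul_norm_coeff_expSeries_le {c : ℕ → ℂ} {B : ℝ} (hc : ∀ j, 1 ≤ j → ‖c j‖ ≤ B)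
    (n : ℕ) : n * ‖coeff n (expSeries c)‖ ≤ B * ∑ k ∈ range n, ‖coeff k (expSeries c)‖ := by
  rw [← Complex.norm_natCast n, ← norm_mul, natCast_mul_coeff_expSeries, mul_sum]
  refine norm_sum_le_of_le _ fun i hi => ?_
  rw [norm_mul, mul_comm]
  exact mul_le_mul_of_nonneg_right (hc _ (Nat.sub_pos_of_lt (mem_range.1 hi))) (norm_nonneg _)

variable {δ D R u : ℝ} {d : ℕ → ℝ} {f : ℕ → ℂ}

lemma mul_sum_pCoeff_le (hδ : 0 ≤ δ) (hd : ∀ j, 1 ≤ j → δ ≤ d j) (n : ℕ) :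
    δ * ∑ k ∈ range n, pCoeff d k ≤ n * pCoeff d n := by
  rw [pCoeff, natCast_mul_coeff_expSeries, mul_sum]
  refine sum_le_sum fun i hi => ?_
  rw [mul_comm]
  exact mul_le_mul_of_nonneg_left (hd _ (Nat.sub_pos_of_lt (mem_range.1 hi)))
    (coeff_expSeries_nonneg (fun j hj => hδ.trans (hd j hj)) i)

lemma norm_ofReal_mul_le (hδ : 0 ≤ δ) (hd : ∀ j, 1 ≤ j → δ ≤ d j ∧ d j ≤ D)
    (hf : ∀ j, 1 ≤ j → ‖f j‖ ≤ R) (j : ℕ) (hj : 1 ≤ j) : ‖(d j : ℂ) * f j‖ ≤ D * R := by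
  have hd₀ : 0 ≤ d j := hδ.trans (hd j hj).1
  rw [norm_mul, Complex.norm_of_nonneg hd₀]
  exact mul_le_mul (hd j hj).2 (hf j hj) (norm_nonneg _) (hd₀.trans (hd j hj).2)

lemma sum_norm_MCoeff_le (hδ : 0 < δ) (hu : 2 * D * u ≤ δ)
    (hd : ∀ j, 1 ≤ j → δ ≤ d j ∧ d j ≤ D) (hf : ∀ j, 1 ≤ j → ‖f j‖ ≤ R) (n : ℕ) :
    ∑ k ∈ range (n + 1), ‖MCoeff d f k‖ ≤
      (1 + 2 * (D * R) * Real.exp (5 / 2 * δ) / (1 - Real.exp (-(δ / 4)))) *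
        Real.exp (logMajorant D d f u n) := by
  exact sum_norm_coeff_expSeries_le (V := logMajorant D d f u) (by positivity)
    (norm_ofReal_mul_le hδ.le hd hf)
    (by simp [logMajorant]) (fun _ => logMajorant_half_add_le hδ.le hu hd)
    (fun n _ => re_eval_logPoly_le hδ.le hu hd n) n

/-- The constant obtained for `|M_n| / p_n` when `δ ≤ d_j ≤ D` and `|f_j| ≤ R`: the product of the
constants for `|M_n|` against `∑ |M_k|`, for `∑ |M_k|` against `exp (logMajorant D d f u n)`, and
for `exp (∑ d_j / j)` against `∑ p_k`. -/
noncomputable def comparisonConst (δ D R : ℝ) : ℝ :=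
  D * R / δ * (1 + 2 * (D * R) * Real.exp (5 / 2 * δ) / (1 - Real.exp (-(δ / 4)))) *
    (2 * Real.exp (D * (⌈2 * D⌉₊ + 1)))

lemma norm_MCoeff_le_mul_pCoeff (hδ : 0 < δ) (hu : 2 * D * u ≤ δ)
    (hd : ∀ j, 1 ≤ j → δ ≤ d j ∧ d j ≤ D) (hf : ∀ j, 1 ≤ j → ‖f j‖ ≤ R) {n : ℕ} (hn : 0 < n) :
    ‖MCoeff d f n‖ ≤ comparisonConst δ D R *
      (‖Complex.exp (L d f n 1)‖ * E f n u ^ D) * pCoeff d n := by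
  set G := ‖Complex.exp (L d f n 1)‖ * E f n u ^ D
  set A := 1 + 2 * (D * R) * Real.exp (5 / 2 * δ) / (1 - Real.exp (-(δ / 4))) with hA
  set B := 2 * Real.exp (D * (⌈2 * D⌉₊ + 1)) with hB
  have hd₀ (j : ℕ) (hj : 1 ≤ j) : 0 ≤ d j := hδ.le.trans (hd j hj).1
  have hD : 0 ≤ D := (hd₀ 1 le_rfl).trans (hd 1 le_rfl).2
  have hR : 0 ≤ R := (norm_nonneg _).trans (hf 1 le_rfl)
  have hG : 0 ≤ G := mul_nonneg (norm_nonneg _) (Real.rpow_nonneg (Real.exp_nonneg _) _)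
  have hA₀ : 0 ≤ A := by
    have : 0 ≤ 1 - Real.exp (-(δ / 4)) := sub_nonneg.2 (Real.exp_le_one_iff.2 (by linarith))
    positivity
  have hupper : ∑ k ∈ range (n + 1), ‖MCoeff d f k‖ ≤ A * Real.exp (logMajorant D d f u n) :=
    sum_norm_MCoeff_le hδ hu hd hf n
  have hlower := exp_sum_div_le_sum_pCoeff hd₀ (fun j hj => (hd j hj).2) hn
  refine le_of_mul_le_mul_left ?_ (Nat.cast_pos.2 hn : (0 : ℝ) < n)
  calc n * ‖MCoeff d f n‖ ≤ D * R * ∑ k ∈ range n, ‖MCoeff d f k‖ :=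
        natCast_mul_norm_coeff_expSeries_le (norm_ofReal_mul_le hδ.le hd hf) n
    _ ≤ D * R * ∑ k ∈ range (n + 1), ‖MCoeff d f k‖ := by
        gcongr
        exact n.le_succ
    _ ≤ D * R * (A * (B * (∑ k ∈ range n, pCoeff d k) * G)) := by
        rw [exp_logMajorant] at hupper
        gcongr
        exact hupper.trans (by gcongr)
    _ = D * R / δ * A * B * G * (δ * ∑ k ∈ range n, pCoeff d k) := by field_simp
    _ ≤ D * R / δ * A * B * G * (n * pCoeff d n) :=
        mul_le_mul_of_nonneg_left (mul_sum_pCoeff_le hδ.le (fun j hj => (hd j hj).1) n)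
          (by positivity)
    _ = n * (comparisonConst δ D R * G * pCoeff d n) := by
        rw [comparisonConst, ← hA, ← hB]
        ring

end Comparison

end VoronoiMean

theorem theorem7_general (dMinus dPlus : ℝ) (hdMinus : 0 < dMinus) (hle : dMinus ≤ dPlus) :
    ∃ η : ℝ, 0 < η ∧ ∀ R : ℝ, ∃ C : ℝ, 0 < C ∧
      ∀ d : ℕ → ℝ, (∀ j, 1 ≤ j → dMinus ≤ d j ∧ d j ≤ dPlus) →
      ∀ f : ℕ → ℂ, (∀ j, 1 ≤ j → ‖f j‖ ≤ R) →
      ∀ (n : ℕ) (u : ℝ), u ≤ η →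
        ‖VoronoiMean.MCoeff d f n * ((VoronoiMean.pCoeff d n : ℝ) : ℂ)⁻¹‖ ≤
          C * ‖Complex.exp (VoronoiMean.L d f n 1)‖ * (VoronoiMean.E f n u) ^ dPlus := by
  have hdPlus : 0 < dPlus := hdMinus.trans_le hle
  refine ⟨dMinus / (2 * dPlus), by positivity, fun R =>
    ⟨max 1 (VoronoiMean.comparisonConst dMinus dPlus R), by positivity, ?_⟩⟩
  intro d hd f hf n u hu
  have hp : 0 ≤ VoronoiMean.pCoeff d n :=
    VoronoiMean.coeff_expSeries_nonneg (fun j hj => hdMinus.le.trans (hd j hj).1) n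
  have hE : 0 ≤ VoronoiMean.E f n u ^ dPlus := Real.rpow_nonneg (Real.exp_nonneg _) _
  rw [mul_assoc, norm_mul, norm_inv, Complex.norm_of_nonneg hp, ← div_eq_mul_inv]
  rcases n.eq_zero_or_pos with rfl | hn
  · simp [VoronoiMean.MCoeff, VoronoiMean.pCoeff, VoronoiMean.coeff_zero_expSeries,
      VoronoiMean.L, VoronoiMean.E]
  · have hu' : 2 * dPlus * u ≤ dMinus := (le_div_iff₀' (by positivity)).1 hu
    refine div_le_of_le_mul₀ hp (by positivity)
      ((VoronoiMean.norm_MCoeff_le_mul_pCoeff hdMinus hu' hd hf hn).trans ?_)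
    gcongr
    exact le_max_right _ _

theorem theorem7 (dMinus dPlus : ℝ) (hdMinus : 0 < dMinus) (hle : dMinus ≤ dPlus) :
    ∃ η C : ℝ, 0 < η ∧ 0 < C ∧
      ∀ d : ℕ → ℝ, (∀ j, 1 ≤ j → dMinus ≤ d j ∧ d j ≤ dPlus) →
      ∀ f : ℕ → ℂ, (∀ j, 1 ≤ j → ‖f j‖ ≤ 1) →
      ∀ (n : ℕ) (u : ℝ), 0 < u → u ≤ η →
        ‖VoronoiMean.MCoeff d f n * ((VoronoiMean.pCoeff d n : ℝ) : ℂ)⁻¹‖ ≤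
          C * ‖Complex.exp (VoronoiMean.L d f n 1)‖ * (VoronoiMean.E f n u) ^ dPlus := by
  obtain ⟨η, hη, h⟩ := theorem7_general dMinus dPlus hdMinus hle
  obtain ⟨C, hC, hbound⟩ := h 1
  exact ⟨η, C, hη, hC, fun d hd f hf n u _ hu => hbound d hd f hf n u hu⟩
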